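/- Let $p$ be a prime number, $k$ an algebraically closed field of characteristic $p$, and for $n\ge 1$ let $\mathbb{F}_{p^n}\subset k$ be the subfield with $p^n$ elements. Let $C\subset\mathbb{P}^2$ be the Fermat curve $X_1^{p+1}+X_2^{p+1}+X_3^{p+1}=0$, let $C^0=C\setminus C(\mathbb{F}_{p^2})$ (as sets of $k$-points), and let $C^0(\mathbb{F}_{p^n})$ be the set of points of $C^0$ that have homogeneous coordinates in $\mathbb{F}_{p^n}$. For $t=(t_1:t_2:t_3)\in C^0(k)$ put $$\mathbb{T}=\begin{pmatrix} t_1&t_1^{p}&t_1^{p^{-1}}\\ t_2&t_2^{p}&t_2^{p^{-1}}\\ t_3&t_3^{p}&t_3^{p^{-1}}\end{pmatrix},$$ let $S_3(\mathbb{F}_{p^2})$ be the $\mathbb{F}_{p^2}$-vector space of symmetric $3\times 3$ matrices over $\mathbb{F}_{p^2}$, let $\psi_t:S_3(\mathbb{F}_{p^2})\to k$ be the $\mathbb{F}_{p^2}$-linear map sending $S$ to the $(1,1)$-component of $\mathbb{T}^{-1}S\,\mathbb{T}$, and let $d(t)=\dim_{\mathbb{F}_{p^2}}\operatorname{Im}(\psi_t)$.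 Let $v=(t_1^2,t_2^2,t_3^2,t_1t_2,t_1t_3,t_2t_3)$, write $v^{(q)}$ for the vector of $q$-th powers of the entries of $v$, and let $\Delta\subset\mathbb{P}^2$ be the locus $$\Delta=\left\{\det\left(v^T,(v^{(p^2)})^T,(v^{(p^4)})^T,\ldots,(v^{(p^{10})})^T\right)=0\right\}.$$ Then for every $t\in C^0(k)$ we have $3\le d(t)\le 6$. If $p=2$, then $d(t)=3$. If $p\ne 2$, then - $d(t)=3$ if and only if $t\in C^0(\mathbb{F}_{p^6})$; - $d(t)=4$ if and only if $t\in C^0(\mathbb{F}_{p^8})$; - $d(t)=5$ if and only if $t\in(\Delta\cap C^0)\setminus\left(C^0(\mathbb{F}_{p^6})\cup C^0(\mathbb{F}_{p^8})\right)$, where the union is disjoint; - $d(t)=6$ if and only if $t\notin\Delta\cap C^0$. -/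

import Mathlib

namespace FermatDim

/-- The subfield `𝔽_{p^n}` of `k`: the fixed field of the `n`-th power of the Frobenius. -/
def Fpn (k : Type*) [Field k] (p : ℕ) [Fact p.Prime] [CharP k p] (n : ℕ) : Subfield k :=
  (iterateFrobenius k p n).eqLocusField (RingHom.id k)

/-- The projective plane over `k`. -/
abbrev Plane (k : Type*) [Field k] : Type _ := Projectivization k (Fin 3 → k)

/-- The `k`-points of the Fermat curve `X₁^{p+1} + X₂^{p+1} + X₃^{p+1} = 0`. -/
def fermatCurve (k : Type*) [Field k] (p : ℕ) : Set (Plane k) :=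
  {P | ∑ i, P.rep i ^ (p + 1) = 0}

/-- The points of the plane that have homogeneous coordinates in `𝔽_{p^n}`. -/
def rationalPoints (k : Type*) [Field k] (p : ℕ) [Fact p.Prime] [CharP k p] (n : ℕ) :
    Set (Plane k) :=
  {P | ∃ (y : Fin 3 → k) (hy : y ≠ 0), Projectivization.mk k y hy = P ∧ ∀ i, y i ∈ Fpn k p n}

/-- `C⁰ = C ∖ C(𝔽_{p²})`. -/
def fermatCurve0 (k : Type*) [Field k] (p : ℕ) [Fact p.Prime] [CharP k p] : Set (Plane k) :=
  fermatCurve k p \ rationalPoints k p 2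

/-- `C⁰(𝔽_{p^n})`. -/
def fermatCurve0Points (k : Type*) [Field k] (p : ℕ) [Fact p.Prime] [CharP k p] (n : ℕ) :
    Set (Plane k) :=
  fermatCurve0 k p ∩ rationalPoints k p n

/-- The vector `v = (t₁², t₂², t₃², t₁t₂, t₁t₃, t₂t₃)`. -/
def veronese {k : Type*} [Field k] (t : Fin 3 → k) : Fin 6 → k :=
  ![t 0 ^ 2, t 1 ^ 2, t 2 ^ 2, t 0 * t 1, t 0 * t 2, t 1 * t 2]

/-- The matrix with columns `v, v^{(p²)}, v^{(p⁴)}, …, v^{(p¹⁰)}`. -/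
def deltaMatrix {k : Type*} [Field k] (p : ℕ) (t : Fin 3 → k) : Matrix (Fin 6) (Fin 6) k :=
  Matrix.of fun i j => veronese t i ^ p ^ (2 * (j : ℕ))

/-- The locus `Δ` in the plane. -/
def Delta (k : Type*) [Field k] (p : ℕ) : Set (Plane k) :=
  {P | (deltaMatrix p P.rep).det = 0}

/-- Membership in the Fermat curve does not depend on the homogeneous coordinates. -/
theorem mk_mem_fermatCurve {k : Type*} [Field k] (p : ℕ) (t : Fin 3 → k) (ht : t ≠ 0) :
    Projectivization.mk k t ht ∈ fermatCurve k p ↔ ∑ i, t i ^ (p + 1) = 0 := by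
  obtain ⟨a, ha⟩ := Projectivization.exists_smul_eq_mk_rep k t ht
  have h : ∀ i, (Projectivization.mk k t ht).rep i = (a : k) * t i := fun i => by
    rw [← ha]; rfl
  simp only [fermatCurve, Set.mem_ofPred_eq, h, mul_pow, ← Finset.mul_sum]
  simp

/-- Membership in `Δ` does not depend on the homogeneous coordinates. -/
theorem mk_mem_Delta {k : Type*} [Field k] (p : ℕ) (t : Fin 3 → k) (ht : t ≠ 0) :
    Projectivization.mk k t ht ∈ Delta k p ↔ (deltaMatrix p t).det = 0 := by
  obtain ⟨a, ha⟩ := Projectivization.exists_smul_eq_mk_rep k t ht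
  have hv : ∀ i, veronese ((Projectivization.mk k t ht).rep) i = (a : k) ^ 2 * veronese t i := by
    intro i
    rw [← ha]
    fin_cases i <;> simp [veronese, Units.smul_def] <;> ring
  have hM : deltaMatrix p (Projectivization.mk k t ht).rep =
      Matrix.of fun (i j : Fin 6) => ((a : k) ^ 2) ^ p ^ (2 * (j : ℕ)) * deltaMatrix p t i j := by
    ext i j
    simp [deltaMatrix, hv, mul_pow]
  have hne : (∏ j : Fin 6, ((a : k) ^ 2) ^ p ^ (2 * (j : ℕ))) ≠ 0 :=
    Finset.prod_ne_zero_iff.mpr fun j _ => pow_ne_zero _ (pow_ne_zero _ a.ne_zero)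
  simp only [Delta, Set.mem_ofPred_eq]
  rw [hM, Matrix.det_mul_row, mul_eq_zero]
  simp only [hne, false_or]

/-- The matrix `𝕋`, whose `i`-th row is `(tᵢ, tᵢ^p, tᵢ^{1/p})`. -/
noncomputable def TMatrix {k : Type*} [Field k] [IsAlgClosed k] (p : ℕ) [Fact p.Prime]
    [CharP k p] (t : Fin 3 → k) : Matrix (Fin 3) (Fin 3) k :=
  Matrix.of fun i => ![t i, t i ^ p, (frobeniusEquiv k p).symm (t i)]

/-- The space `S₃(F)` of symmetric `3 × 3` matrices over a field `F`. -/
def S3 (F : Type*) [Field F] : Submodule F (Matrix (Fin 3) (Fin 3) F) where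
  carrier := {S | S.IsSymm}
  add_mem' hA hB := hA.add hB
  zero_mem' := Matrix.isSymm_zero
  smul_mem' c _ hA := hA.smul c

/-- The `𝔽_{p²}`-linear map `ψ_t : S₃(𝔽_{p²}) → k` sending `S` to the `(1,1)`-component of
`𝕋⁻¹ S 𝕋`. -/
noncomputable def psi {k : Type*} [Field k] [IsAlgClosed k] (p : ℕ) [Fact p.Prime]
    [CharP k p] (t : Fin 3 → k) : S3 (Fpn k p 2) →ₗ[Fpn k p 2] k where
  toFun S := ((TMatrix p t)⁻¹ *
    (S : Matrix (Fin 3) (Fin 3) (Fpn k p 2)).map (algebraMap (Fpn k p 2) k) * TMatrix p t) 0 0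
  map_add' A B := by
    simp [Matrix.map_add, Matrix.mul_add, Matrix.add_mul]
  map_smul' c A := by
    have h : (((c • A : S3 (Fpn k p 2)) : Matrix (Fin 3) (Fin 3) (Fpn k p 2)).map
        (algebraMap (Fpn k p 2) k)) =
        (c : k) • (A : Matrix (Fin 3) (Fin 3) (Fpn k p 2)).map (algebraMap (Fpn k p 2) k) := by
      ext i j
      rfl
    rw [h, Matrix.mul_smul, Matrix.smul_mul]
    rfl

/-- `d(t)`, the dimension over `𝔽_{p²}` of the image of `ψ_t`. -/
noncomputable def d {k : Type*} [Field k] [IsAlgClosed k] (p : ℕ) [Fact p.Prime]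
    [CharP k p] (t : Fin 3 → k) : ℕ :=
  Module.finrank (Fpn k p 2) (LinearMap.range (psi p t))

end FermatDim

/-! The curve equation and its `p`-th root say that `t` is orthogonal to the last two columns of
`𝕋`. Hence the first row of `𝕋⁻¹` is `c t` with `c ≠ 0` (`exists_TMatrix_inv_row`), and `ψ_t(S) = c
· tᵀ S t`. Let `V` be the `𝔽_{p²}`-span of the `tᵢ`. A point of the curve outside `C(𝔽_{p²})` lies
on no `𝔽_{p²}`-line, so `dim V = 3`.

For `p = 2` the off-diagonal terms cancel; the image is spanned by the `c tᵢ²`, which are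
independent because squaring is a field automorphism. For odd `p` the image is `c · V·V`, spanned by
the entries of `c v`, so `d(t) = dim V·V ≤ 6`, with equality exactly when a Moore determinant is
nonzero (`moore_det_ne_zero_iff`).

Scaling so that `1 ∈ V` gives `V ⊆ V·V`. Dimension 3 makes `V` a subalgebra, hence the cubic
extension `𝔽_{p⁶}`. Dimension 4 puts `V` in a quartic extension, hence in `𝔽_{p⁸}`
(`exists_intermediateField_of_finrank_mul_self_eq_four`). Dimension 5 is what remains. -/

namespace FermatDim

open Polynomial Module

/-! ### Finite subfields, additive polynomials and the Moore determinant. -/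

section FiniteSubfields

variable {k : Type*} [Field k] (p : ℕ) [Fact p.Prime] [CharP k p]

theorem mem_Fpn {n : ℕ} {x : k} : x ∈ Fpn k p n ↔ x ^ p ^ n = x := by
  simp [Fpn, RingHom.mem_eqLocusField, iterateFrobenius_def]

theorem Fpn_le_of_dvd {m n : ℕ} (h : m ∣ n) : Fpn k p m ≤ Fpn k p n := by
  obtain ⟨c, rfl⟩ := h
  intro x hx
  rw [mem_Fpn] at hx ⊢
  induction c with
  | zero => simp
  | succ c ih => rw [Nat.mul_succ, pow_add, pow_mul, ih, hx]

theorem coe_Fpn_eq_rootSet {n : ℕ} (hn : n ≠ 0) :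
    (Fpn k p n : Set k) = (X ^ p ^ n - X : k[X]).rootSet k := by
  ext x
  rw [mem_rootSet_of_ne
    (FiniteField.X_pow_card_pow_sub_X_ne_zero k hn (Fact.out : p.Prime).one_lt)]
  simp [mem_Fpn, sub_eq_zero]

theorem finite_Fpn {n : ℕ} (hn : n ≠ 0) : Finite (Fpn k p n) := by
  have h : (Fpn k p n : Set k).Finite := by
    rw [coe_Fpn_eq_rootSet p hn]
    exact rootSet_finite _ _
  exact h.to_subtype

theorem natCard_Fpn [IsAlgClosed k] {n : ℕ} (hn : n ≠ 0) : Nat.card (Fpn k p n) = p ^ n := by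
  have h : Nat.card (Fpn k p n) = Nat.card ((X ^ p ^ n - X : k[X]).rootSet k) := by
    rw [← coe_Fpn_eq_rootSet p hn]
    rfl
  rw [h, Nat.card_eq_fintype_card, card_rootSet_eq_natDegree
    (galois_poly_separable p _ (dvd_pow_self p hn)) (IsAlgClosed.splits _),
    FiniteField.X_pow_card_pow_sub_X_natDegree_eq k hn (Fact.out : p.Prime).one_lt]

/-- A finite-dimensional subalgebra of degree `m` over `𝔽_{p^n}` lies in `𝔽_{p^{nm}}`. -/
theorem mem_Fpn_of_mem_subalgebra [IsAlgClosed k] {n m : ℕ} (hn : n ≠ 0) (hm : m ≠ 0)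
    (A : Subalgebra (Fpn k p n) k) (hA : finrank (Fpn k p n) A = m) {x : k} (hx : x ∈ A) :
    x ∈ Fpn k p (n * m) := by
  have := finite_Fpn (k := k) p hn
  have : FiniteDimensional (Fpn k p n) A :=
    FiniteDimensional.of_finrank_pos (by omega)
  have : Finite A := Module.finite_of_finite (Fpn k p n)
  -- A finite domain is a field, so every element is fixed by the power `|A| = p^{nm}`.
  have hF : IsField A := Finite.isField_of_domain A
  let := hF.toField
  let := Fintype.ofFinite A
  have hcard : Fintype.card A = p ^ (n * m) := by
    rw [← Nat.card_eq_fintype_card, Module.natCard_eq_pow_finrank (K := Fpn k p n),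
      natCard_Fpn p hn, hA, pow_mul]
  have h := FiniteField.pow_card (⟨x, hx⟩ : A)
  rw [hcard] at h
  rw [mem_Fpn]
  exact congrArg Subtype.val h

/-- `𝔽_{p^{nm}}` as a subspace of `k` over `𝔽_{p^n}`. -/
def FpnSubmodule (k : Type*) [Field k] (p : ℕ) [Fact p.Prime] [CharP k p] (n m : ℕ) :
    Submodule (Fpn k p n) k where
  carrier := Fpn k p (n * m)
  add_mem' := add_mem
  zero_mem' := zero_mem _
  smul_mem' c _ hx := mul_mem (Fpn_le_of_dvd p (dvd_mul_right n m) c.2) hx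

theorem mem_FpnSubmodule {n m : ℕ} {x : k} :
    x ∈ FpnSubmodule k p n m ↔ x ∈ Fpn k p (n * m) := Iff.rfl

theorem finite_FpnSubmodule {n m : ℕ} (hn : n ≠ 0) (hm : m ≠ 0) :
    Finite (FpnSubmodule k p n m) :=
  finite_Fpn (k := k) p (mul_ne_zero hn hm)

theorem finrank_FpnSubmodule [IsAlgClosed k] {n m : ℕ} (hn : n ≠ 0) (hm : m ≠ 0) :
    finrank (Fpn k p n) (FpnSubmodule k p n m) = m := by
  have := finite_FpnSubmodule (k := k) p hn hm
  have := finite_Fpn (k := k) p hn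
  have h1 : Nat.card (FpnSubmodule k p n m) = p ^ (n * m) :=
    natCard_Fpn (k := k) p (mul_ne_zero hn hm)
  rw [Module.natCard_eq_pow_finrank (K := Fpn k p n), natCard_Fpn p hn, ← pow_mul] at h1
  exact Nat.eq_of_mul_eq_mul_left (Nat.pos_of_ne_zero hn)
    (Nat.pow_right_injective (Fact.out : p.Prime).two_le h1)

/-- The additive polynomial map `x ↦ ∑ cⱼ x^{p^{sj}}` is linear over `𝔽_{p^s}`. -/
def additiveMap (s : ℕ) {n : ℕ} (c : Fin n → k) : k →ₗ[Fpn k p s] k where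
  toFun x := ∑ j, c j * x ^ p ^ (s * (j : ℕ))
  map_add' x y := by
    simp [add_pow_char_pow, mul_add, Finset.sum_add_distrib]
  map_smul' a x := by
    have h (j : ℕ) : (a : k) ^ p ^ (s * j) = a :=
      (mem_Fpn p).1 (Fpn_le_of_dvd p (dvd_mul_right s j) a.2)
    simp only [Subfield.smul_def, smul_eq_mul, mul_pow, h, RingHom.id_apply, Finset.mul_sum]
    exact Finset.sum_congr rfl fun j _ => by ring

/-- An additive polynomial of degree less than `p^{sn}` that vanishes at `n` elements independent
over `𝔽_{p^s}` is zero. -/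
theorem eq_zero_of_additiveMap_eq_zero [IsAlgClosed k] {s n : ℕ} (hs : s ≠ 0) {v : Fin n → k}
    (hv : LinearIndependent (Fpn k p s) v) {c : Fin n → k}
    (h : ∀ i, ∑ j, c j * v i ^ p ^ (s * (j : ℕ)) = 0) : c = 0 := by
  classical
  have hp : 1 < p := (Fact.out : p.Prime).one_lt
  obtain rfl | hn := Nat.eq_zero_or_pos n
  · exact Subsingleton.elim _ _
  have := finite_Fpn (k := k) p hs
  let P : k[X] := ∑ j : Fin n, C (c j) * X ^ p ^ (s * (j : ℕ))
  have hinj : Function.Injective fun j : Fin n => p ^ (s * (j : ℕ)) := fun i j hij =>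
    Fin.ext (Nat.eq_of_mul_eq_mul_left (Nat.pos_of_ne_zero hs) (Nat.pow_right_injective hp hij))
  have hcoeff (i : Fin n) : P.coeff (p ^ (s * (i : ℕ))) = c i := by
    simp only [P, finsetSum_coeff, coeff_C_mul, coeff_X_pow]
    rw [Finset.sum_eq_single i]
    · simp
    · intro j _ hj
      rw [if_neg fun e => hj (hinj e).symm, mul_zero]
    · simp
  by_contra hc
  have hP : P ≠ 0 := fun hP => hc (funext fun i => by rw [← hcoeff i, hP]; simp)
  have hdeg : P.natDegree ≤ p ^ (s * (n - 1)) := by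
    refine natDegree_sum_le_of_forall_le _ _ fun j _ => (natDegree_C_mul_X_pow_le _ _).trans ?_
    exact Nat.pow_le_pow_right hp.le (Nat.mul_le_mul_left _ (by omega))
  let V := Submodule.span (Fpn k p s) (Set.range v)
  have hV : V ≤ LinearMap.ker (additiveMap p s c) := by
    rw [Submodule.span_le]
    rintro _ ⟨i, rfl⟩
    exact h i
  have : FiniteDimensional (Fpn k p s) V := FiniteDimensional.span_of_finite _ (Set.finite_range v)
  have hfin : Finite V := Module.finite_of_finite (Fpn k p s)
  have hcardV : Nat.card V = p ^ (s * n) := by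
    rw [Module.natCard_eq_pow_finrank (K := Fpn k p s), natCard_Fpn p hs,
      finrank_span_eq_card hv, Fintype.card_fin, pow_mul]
  have hsub : (V : Set k) ⊆ P.rootSet k := by
    intro x hx
    rw [mem_rootSet_of_ne hP]
    have hx0 : ∑ j, c j * x ^ p ^ (s * (j : ℕ)) = 0 := hV hx
    simpa [P] using hx0
  -- The roots include the whole span, which has `p^{sn}` elements, more than the degree allows.
  have h1 : Nat.card V ≤ P.natDegree := by
    calc Nat.card V = (V : Set k).ncard := rfl
      _ ≤ (P.rootSet k).ncard := Set.ncard_le_ncard hsub (rootSet_finite _ _)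
      _ ≤ P.natDegree := ncard_rootSet_le P k
  rw [hcardV] at h1
  have h2 : p ^ (s * (n - 1)) < p ^ (s * n) :=
    Nat.pow_lt_pow_right hp (Nat.mul_lt_mul_of_pos_left (by omega) (Nat.pos_of_ne_zero hs))
  omega

/-- The Moore determinant criterion for independence over `𝔽_{p^s}`. -/
theorem moore_det_ne_zero_iff [IsAlgClosed k] {s n : ℕ} (hs : s ≠ 0) (v : Fin n → k) :
    (Matrix.of fun i j : Fin n => v i ^ p ^ (s * (j : ℕ))).det ≠ 0 ↔
      LinearIndependent (Fpn k p s) v := by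
  constructor
  · intro hdet
    rw [Fintype.linearIndependent_iff]
    intro g hg
    have h0 : (fun i => (g i : k)) = 0 := by
      by_contra hne
      refine hdet (Matrix.exists_vecMul_eq_zero_iff.1 ⟨_, hne, ?_⟩)
      ext j
      -- Applying `x ↦ x^{p^{sj}}` to the relation leaves its coefficients fixed and gives column
      -- `j`.
      have := congrArg (additiveMap p s (n := n) (Pi.single j 1)) hg
      rw [map_sum, map_zero] at this
      simp only [map_smul] at this
      simpa [additiveMap, Pi.single_apply, Matrix.vecMul, dotProduct, Subfield.smul_def]
        using this
    exact fun i => Subtype.ext (congrFun h0 i)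
  · intro hv hdet
    obtain ⟨c, hc, h⟩ := Matrix.exists_mulVec_eq_zero_iff.2 hdet
    refine hc (eq_zero_of_additiveMap_eq_zero p hs hv fun i => ?_)
    have := congrFun h i
    simpa [Matrix.mulVec, dotProduct, mul_comm] using this

end FiniteSubfields

end FermatDim

namespace FermatDim

open Polynomial Module

/-! ### Three-dimensional subspaces with small square. -/

section SmallSquares

variable {F K : Type*} [Field F] [Field K] [Algebra F K]

theorem le_mul_self_of_one_mem {V : Submodule F K} (h1 : (1 : K) ∈ V) : V ≤ V * V :=
  fun x hx => by simpa using Submodule.mul_mem_mul h1 hx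

/-- If `V` contains `1` and its square has the same dimension, then `V` is a subalgebra. -/
theorem exists_subalgebra_eq_of_finrank_mul_self {V : Submodule F K} (h1 : (1 : K) ∈ V)
    [FiniteDimensional F V] (h : finrank F ↥(V * V) = finrank F V) :
    ∃ A : Subalgebra F K, Subalgebra.toSubmodule A = V := by
  have : FiniteDimensional F ↥(V * V) := Module.Finite.iff_fg.2
    (Submodule.FG.mul (Module.Finite.iff_fg.1 ‹_›) (Module.Finite.iff_fg.1 ‹_›))
  have hV : V = V * V := Submodule.eq_of_le_of_finrank_eq (le_mul_self_of_one_mem h1) h.symm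
  exact ⟨V.toSubalgebra h1 fun x y hx hy => by rw [hV]; exact Submodule.mul_mem_mul hx hy, rfl⟩

/-- A three-dimensional space containing `1` whose square has dimension four lies in an extension
of degree four. -/
theorem exists_intermediateField_of_finrank_mul_self_eq_four {V : Submodule F K}
    (h1 : (1 : K) ∈ V) (h2 : (2 : F) ≠ 0) (h3 : finrank F V = 3)
    (h4 : finrank F ↥(V * V) = 4) :
    ∃ E : IntermediateField F K, finrank F E = 4 ∧ ∀ x ∈ V, x ∈ E := by
  have : FiniteDimensional F V := FiniteDimensional.of_finrank_pos (by omega)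
  have : FiniteDimensional F ↥(V * V) := FiniteDimensional.of_finrank_pos (by omega)
  have hVV : ¬ V * V ≤ V := fun h => by
    have := Submodule.finrank_mono h
    omega
  -- Otherwise polarisation, with 2 invertible, would give `V·V ≤ V`.
  obtain ⟨x, hx, hxx⟩ : ∃ x ∈ V, x * x ∉ V := by
    by_contra! hsq
    refine hVV (Submodule.mul_le.2 fun a ha b hb => ?_)
    have h := V.sub_mem (V.sub_mem (hsq _ (V.add_mem ha hb)) (hsq _ ha)) (hsq _ hb)
    have h' : (2 : F) • (a * b) ∈ V := by
      convert h using 1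
      rw [Algebra.smul_def, map_ofNat]
      ring
    simpa [smul_smul, h2] using V.smul_mem (2 : F)⁻¹ h'
  have : FiniteDimensional F (Submodule.span F {1, x}) :=
    FiniteDimensional.span_of_finite _ (by simp)
  have hspan2 : finrank F (Submodule.span F {1, x}) ≤ 2 := by
    classical
    have h := finrank_span_finset_le_card (R := F) ({1, x} : Finset K)
    rw [Finset.coe_pair] at h
    exact h.trans Finset.card_le_two
  obtain ⟨y₀, hy₀, hy₀'⟩ : ∃ y ∈ V, y ∉ Submodule.span F {1, x} := by
    by_contra! h
    have := Submodule.finrank_mono (show V ≤ Submodule.span F {1, x} from h)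
    omega
  -- `V` has codimension one in `V·V`, so adjoining `x²` fills it.
  have hsup : V ⊔ Submodule.span F {x * x} = V * V := by
    have hle : V ⊔ Submodule.span F {x * x} ≤ V * V :=
      sup_le (le_mul_self_of_one_mem h1)
        ((Submodule.span_singleton_le_iff_mem _ _).2 (Submodule.mul_mem_mul hx hx))
    refine Submodule.eq_of_le_of_finrank_le hle ?_
    have hlt : V < V ⊔ Submodule.span F {x * x} := by
      refine lt_of_le_of_ne le_sup_left fun h => hxx ?_
      rw [h]
      exact Submodule.mem_sup_right (Submodule.mem_span_singleton_self _)
    have : FiniteDimensional F ↥(V ⊔ Submodule.span F {x * x}) :=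
      Submodule.finiteDimensional_of_le hle
    have := Submodule.finrank_lt_finrank_of_lt hlt
    omega
  have hxy₀ : x * y₀ ∈ V ⊔ Submodule.span F {x * x} := hsup ▸ Submodule.mul_mem_mul hx hy₀
  obtain ⟨w, hw, z, hz, hwz⟩ := Submodule.mem_sup.1 hxy₀
  obtain ⟨c, rfl⟩ := Submodule.mem_span_singleton.1 hz
  have hxmem : x ∈ Submodule.span F {1, x} := Submodule.subset_span (by simp)
  have h1mem : (1 : K) ∈ Submodule.span F {1, x} := Submodule.subset_span (by simp)
  -- Subtracting a multiple of `x` from `y₀` removes the `x²` component of `x y₀`.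
  obtain ⟨y, hy, hy', hxy⟩ : ∃ y ∈ V, y ∉ Submodule.span F {1, x} ∧ x * y ∈ V := by
    refine ⟨y₀ - c • x, V.sub_mem hy₀ (V.smul_mem _ hx), fun h => hy₀' ?_, ?_⟩
    · simpa using add_mem h (Submodule.smul_mem _ c hxmem)
    · rw [mul_sub, ← hwz, mul_smul_comm, add_sub_cancel_right]
      exact hw
  have hx1 : x ∉ Submodule.span F {(1 : K)} := by
    intro h
    obtain ⟨a, rfl⟩ := Submodule.mem_span_singleton.1 h
    exact hxx (by simpa [smul_smul] using V.smul_mem (a * a) h1)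
  have hV : Submodule.span F {1, x, y} = V := by
    have hle : Submodule.span F {1, x, y} ≤ V := by
      rw [Submodule.span_le]
      rintro z (rfl | rfl | rfl) <;> assumption
    refine Submodule.eq_of_le_of_finrank_le hle ?_
    have hlt1 : Submodule.span F {(1 : K)} < Submodule.span F {1, x} :=
      lt_of_le_of_ne (Submodule.span_mono (by simp)) fun h => hx1 (h ▸ hxmem)
    have hlt2 : Submodule.span F {1, x} < Submodule.span F {1, x, y} :=
      lt_of_le_of_ne (Submodule.span_mono (by grind)) fun h =>
        hy' (h ▸ Submodule.subset_span (by simp))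
    have : FiniteDimensional F (Submodule.span F {1, x, y}) :=
      FiniteDimensional.span_of_finite _ (by simp)
    have e1 := Submodule.finrank_lt_finrank_of_lt hlt1
    have e2 := Submodule.finrank_lt_finrank_of_lt hlt2
    rw [finrank_span_singleton one_ne_zero] at e1
    omega
  obtain ⟨a, b, c', habc⟩ := Submodule.mem_span_triple.1 (hV.symm ▸ hxy)
  simp only [Algebra.smul_def, mul_one] at habc
  set u := x - algebraMap F K c' with hu
  set w' := y - algebraMap F K b with hw'
  set e := a + b * c' with he
  have huw : u * w' = algebraMap F K e := by
    rw [hu, hw', he, map_add, map_mul]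
    linear_combination -habc
  have halg (r : F) : algebraMap F K r ∈ V := by
    rw [Algebra.algebraMap_eq_smul_one]
    exact V.smul_mem _ h1
  have huV : u ∈ V := V.sub_mem hx (halg _)
  have hwV : w' ∈ V := V.sub_mem hy (halg _)
  have hu0 : u ≠ 0 := fun h => hx1 (Submodule.mem_span_singleton.2 ⟨c', by
    rw [← Algebra.algebraMap_eq_smul_one, ← sub_eq_zero.1 h]⟩)
  have hw0 : w' ≠ 0 := fun h => hy' (by
    rw [sub_eq_zero.1 h, Algebra.algebraMap_eq_smul_one]
    exact Submodule.smul_mem _ _ h1mem)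
  have he0 : e ≠ 0 := fun h => mul_ne_zero hu0 hw0 (by rw [huw, h, map_zero])
  have he0' : algebraMap F K e ≠ 0 := (_root_.map_ne_zero _).2 he0
  have huinv : u⁻¹ ∈ V := by
    have : u⁻¹ = e⁻¹ • w' := by
      rw [Algebra.smul_def, map_inv₀, ← huw]
      field_simp
    rw [this]
    exact V.smul_mem _ hwV
  let E := IntermediateField.adjoin F {u}
  have huE : u ∈ E := IntermediateField.mem_adjoin_simple_self F u
  have hwE : w' ∈ E := by
    have : w' = algebraMap F K e * u⁻¹ := by
      rw [← huw]
      field_simp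
    rw [this]
    exact E.mul_mem (E.algebraMap_mem _) (E.inv_mem huE)
  have hVE : V ≤ Subalgebra.toSubmodule E.toSubalgebra := by
    rw [← hV, Submodule.span_le]
    rintro z (rfl | rfl | rfl)
    · exact E.one_mem
    · simpa [hu] using E.add_mem huE (E.algebraMap_mem c')
    · simpa [hw'] using E.add_mem hwE (E.algebraMap_mem b)
  -- The five powers `u⁻², …, u²` lie in the four-dimensional `V·V`; multiplying a dependence by
  -- `u²` gives a polynomial of degree at most 4.
  obtain ⟨P, hP, hdeg, hroot⟩ : ∃ P : F[X], P ≠ 0 ∧ P.natDegree ≤ 4 ∧ aeval u P = 0 := by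
    let f : Fin 5 → ↥(V * V) := fun i => ⟨u ^ (i : ℕ) * (u⁻¹ * u⁻¹), by
      fin_cases i
      · simpa using Submodule.mul_mem_mul huinv huinv
      · simpa [hu0] using Submodule.mul_mem_mul h1 huinv
      · simpa [hu0, pow_two, mul_assoc] using Submodule.mul_mem_mul h1 h1
      · have : u ^ 3 * (u⁻¹ * u⁻¹) = u * 1 := by field_simp
        simpa [this] using Submodule.mul_mem_mul huV h1
      · have : u ^ 4 * (u⁻¹ * u⁻¹) = u * u := by field_simp
        simpa [this] using Submodule.mul_mem_mul huV huV⟩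
    have hf : ¬ LinearIndependent F f := fun h => by
      have := h.fintype_card_le_finrank
      rw [h4, Fintype.card_fin] at this
      omega
    rw [Fintype.linearIndependent_iff] at hf
    push Not at hf
    obtain ⟨g, hg, i, hi⟩ := hf
    refine ⟨∑ j : Fin 5, C (g j) * X ^ (j : ℕ), fun h => hi ?_, ?_, ?_⟩
    · have := congrArg (coeff · (i : ℕ)) h
      simpa [finsetSum_coeff, coeff_C_mul, coeff_X_pow, Fin.val_inj] using this
    · exact natDegree_sum_le_of_forall_le _ _ fun j _ =>
        (natDegree_C_mul_X_pow_le _ _).trans (by omega)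
    · have h := congrArg (Subtype.val) hg
      have h' : (∑ j : Fin 5, algebraMap F K (g j) * u ^ (j : ℕ)) * (u⁻¹ * u⁻¹) = 0 := by
        rw [Finset.sum_mul]
        simpa [f, Algebra.smul_def, mul_assoc] using h
      simpa [hu0] using h'
  have hint : IsIntegral F u := IsAlgebraic.isIntegral ⟨P, hP, hroot⟩
  have hE4 : finrank F E ≤ 4 := by
    rw [IntermediateField.adjoin.finrank hint]
    exact (natDegree_le_of_dvd (minpoly.dvd F u hroot) hP).trans hdeg
  have : FiniteDimensional F E := IntermediateField.adjoin.finiteDimensional hint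
  have : FiniteDimensional F (Subalgebra.toSubmodule E.toSubalgebra) := this
  have hEE : V * V ≤ Subalgebra.toSubmodule E.toSubalgebra :=
    Submodule.mul_le.2 fun m hm n hn => E.mul_mem (hVE hm) (hVE hn)
  have hge : finrank F ↥(V * V) ≤ finrank F E := Submodule.finrank_mono hEE
  exact ⟨E, by omega, fun x hx => hVE hx⟩

end SmallSquares

end FermatDim

namespace FermatDim

open Module

/-! ### Independence of the coordinates and the first row of `𝕋⁻¹`. -/

section Independence

variable {k : Type*} [Field k]

theorem mul_eq_mul_of_parallel {u u' n : Fin 3 → k} (hn : n ≠ 0)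
    (h : ∀ i j, u i * n j = u j * n i) (h' : ∀ i j, u' i * n j = u' j * n i) (i j : Fin 3) :
    u i * u' j = u j * u' i := by
  obtain ⟨l, hl⟩ := Function.ne_iff.1 hn
  have hl : n l ≠ 0 := hl
  apply mul_right_cancel₀ (mul_ne_zero hl hl)
  calc u i * u' j * (n l * n l) = (u i * n l) * (u' j * n l) := by ring
    _ = (u j * n l) * (u' i * n l) := by rw [h i l, h' j l, h j l, h' i l]; ring
    _ = u j * u' i * (n l * n l) := by ring

theorem parallel_crossProduct {u a w : Fin 3 → k} (ha : ∑ i, a i * u i = 0)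
    (hw : ∑ i, w i * u i = 0) (i j : Fin 3) :
    u i * crossProduct a w j = u j * crossProduct a w i := by
  rw [Fin.sum_univ_three] at ha hw
  simp only [cross_apply]
  fin_cases i <;> fin_cases j <;> simp <;> grind

variable (p : ℕ) [Fact p.Prime] [CharP k p]

/-- A point on the Fermat curve that lies on an `𝔽_{p²}`-line is proportional to its
`p²`-Frobenius conjugate. -/
theorem frobenius_parallel_of_mem_line {t a : Fin 3 → k} (hC : ∑ i, t i ^ (p + 1) = 0)
    (ha : ∀ i, a i ∈ Fpn k p 2) (ha0 : a ≠ 0) (h : ∑ i, a i * t i = 0) (i j : Fin 3) :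
    t i * t j ^ p ^ 2 = t j * t i ^ p ^ 2 := by
  have ha' (i) : a i ^ p ^ 2 = a i := (mem_Fpn p).1 (ha i)
  by_cases hn : crossProduct a (fun i => t i ^ p) = 0
  -- Here `t^{(p)}` is parallel to `a`, hence so is its `p²`-conjugate; injectivity of Frobenius
  -- then removes the exponent `p`.
  · have hpar (i j : Fin 3) : t i ^ p * a j = t j ^ p * a i := by
      have h0 := congrFun hn 0
      have h1 := congrFun hn 1
      have h2 := congrFun hn 2
      simp only [cross_apply, Matrix.cons_val, Pi.zero_apply] at h0 h1 h2
      fin_cases i <;> fin_cases j <;> simp <;> grind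
    have hpar' (i j : Fin 3) : (t i ^ p) ^ p ^ 2 * a j = (t j ^ p) ^ p ^ 2 * a i := by
      have := congrArg (· ^ p ^ 2) (hpar i j)
      simpa only [mul_pow, ha'] using this
    have key := mul_eq_mul_of_parallel (u := fun i => t i ^ p) (u' := fun i => (t i ^ p) ^ p ^ 2)
      ha0 hpar hpar' i j
    apply frobenius_inj k p
    simp only [frobenius_def, mul_pow]
    simpa only [pow_right_comm] using key
  -- Both `t` and `t^{(p²)}` are orthogonal to `a` and to `t^{(p)}`, so both are parallel to the
  -- nonzero cross product.
  · refine mul_eq_mul_of_parallel (u := t) (u' := fun i => t i ^ p ^ 2) hn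
      (parallel_crossProduct h ?_) (parallel_crossProduct ?_ ?_) i j
    · simpa only [pow_succ] using hC
    · have := congrArg (· ^ p ^ 2) h
      simpa [sum_pow_char_pow, mul_pow, ha', zero_pow, (Fact.out : p.Prime).ne_zero] using this
    · have := congrArg (· ^ p) hC
      simp only [sum_pow_char, zero_pow (Fact.out : p.Prime).ne_zero] at this
      rw [← this]
      exact Finset.sum_congr rfl fun i _ => by ring

theorem mk_mem_rationalPoints_iff {t : Fin 3 → k} (ht : t ≠ 0) {n : ℕ} {l : Fin 3} (hl : t l ≠ 0) :
    Projectivization.mk k t ht ∈ rationalPoints k p n ↔ ∀ i, (t l)⁻¹ * t i ∈ Fpn k p n := by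
  constructor
  · rintro ⟨y, hy, hyt, hmem⟩ i
    obtain ⟨a, ha⟩ := (Projectivization.mk_eq_mk_iff' k _ _ hy ht).1 hyt
    have hyi (i) : y i = a * t i := by rw [← ha]; rfl
    have ha0 : a ≠ 0 := by
      rintro rfl
      exact hy (by rw [← ha, zero_smul])
    have h : (t l)⁻¹ * t i = (y l)⁻¹ * y i := by
      rw [hyi, hyi]
      field_simp
    rw [h]
    exact mul_mem (inv_mem (hmem l)) (hmem i)
  · intro h
    have hy : (t l)⁻¹ • t ≠ 0 := smul_ne_zero (inv_ne_zero hl) ht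
    exact ⟨_, hy, (Projectivization.mk_eq_mk_iff' k _ _ hy ht).2 ⟨_, rfl⟩, h⟩

/-- A dependence is an `𝔽_{p²}`-line through the point; proportionality to the `p²`-conjugate then
makes all coordinate ratios `𝔽_{p²}`-rational. -/
theorem linearIndependent_of_mem_fermatCurve0 {t : Fin 3 → k} (ht : t ≠ 0)
    (htC : Projectivization.mk k t ht ∈ fermatCurve0 k p) :
    LinearIndependent (Fpn k p 2) t := by
  rw [Fintype.linearIndependent_iff]
  intro g hg
  by_contra! hne
  obtain ⟨i, hi⟩ := hne
  obtain ⟨l, hl⟩ := Function.ne_iff.1 ht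
  have hl : t l ≠ 0 := hl
  refine htC.2 ((mk_mem_rationalPoints_iff p ht hl).2 fun j => ?_)
  have h := frobenius_parallel_of_mem_line p (a := fun i => (g i : k))
    ((mk_mem_fermatCurve p t ht).1 htC.1) (fun i => (g i).2)
    (fun h => hi (Subtype.ext (congrFun h i))) hg l j
  rw [mem_Fpn, mul_pow, inv_pow]
  field_simp
  linear_combination h

theorem linearIndependent_Fpn_of_dvd {m n : ℕ} (h : m ∣ n) {ι : Type*} [Fintype ι] {v : ι → k}
    (hv : LinearIndependent (Fpn k p n) v) : LinearIndependent (Fpn k p m) v := by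
  rw [Fintype.linearIndependent_iff] at hv ⊢
  intro g hg i
  have := hv (fun i => ⟨g i, Fpn_le_of_dvd p h (g i).2⟩) hg i
  exact Subtype.ext (congrArg (fun x : Fpn k p n => (x : k)) this)

variable [IsAlgClosed k]

theorem TMatrix_det_ne_zero {t : Fin 3 → k} (ht : LinearIndependent (Fpn k p 2) t) :
    (TMatrix p t).det ≠ 0 := by
  intro hdet
  obtain ⟨c, hc, h⟩ := Matrix.exists_mulVec_eq_zero_iff.2 hdet
  have hp : p ≠ 0 := (Fact.out : p.Prime).ne_zero
  -- The `p`-th power of a column relation involves `t`, `t^{(p)}`, `t^{(p²)}`; the column `t^{1/p}`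
  -- becomes the lowest term, whence the cyclic shift of coefficients.
  have key := eq_zero_of_additiveMap_eq_zero p one_ne_zero
    (linearIndependent_Fpn_of_dvd p (one_dvd 2) ht) (c := ![c 2 ^ p, c 0 ^ p, c 1 ^ p]) fun i => by
      have hi := congrFun h i
      simp only [TMatrix, Matrix.mulVec, dotProduct, Fin.sum_univ_three, Matrix.of_apply,
        Matrix.cons_val, Pi.zero_apply] at hi
      have hi' := congrArg (· ^ p) hi
      simp only [add_pow_char, mul_pow, zero_pow hp, frobeniusEquiv_symm_pow_p] at hi'
      rw [← hi']
      simp [Fin.sum_univ_three]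
      ring
  refine hc (funext fun i => ?_)
  have h0 := congrFun key 0
  have h1 := congrFun key 1
  have h2 := congrFun key 2
  simp [hp] at h0 h1 h2
  fin_cases i <;> simpa

/-- On the curve, the first row of `𝕋⁻¹` is proportional to `t`. -/
theorem exists_TMatrix_inv_row {t : Fin 3 → k} (hC : ∑ i, t i ^ (p + 1) = 0) (ht0 : t ≠ 0)
    (ht : LinearIndependent (Fpn k p 2) t) :
    ∃ c : k, c ≠ 0 ∧ ∀ j, (TMatrix p t)⁻¹ 0 j = c * t j := by
  have hT : IsUnit (TMatrix p t).det := (TMatrix_det_ne_zero p ht).isUnit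
  have hp : p ≠ 0 := (Fact.out : p.Prime).ne_zero
  have hrow : Matrix.vecMul t (TMatrix p t) = Pi.single 0 (∑ i, t i * t i) := by
    ext j
    fin_cases j
    · simp [Matrix.vecMul, dotProduct, TMatrix]
    · simpa [Matrix.vecMul, dotProduct, TMatrix, pow_succ'] using hC
    · apply frobenius_inj k p
      simp only [Matrix.vecMul, dotProduct, TMatrix, map_sum, map_mul, frobenius_def]
      simpa [hp, pow_succ] using hC
  have h : t = fun j => (∑ i, t i * t i) * (TMatrix p t)⁻¹ 0 j := by
    calc t = Matrix.vecMul (Matrix.vecMul t (TMatrix p t)) (TMatrix p t)⁻¹ := by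
          rw [Matrix.vecMul_vecMul, Matrix.mul_nonsing_inv _ hT, Matrix.vecMul_one]
      _ = _ := by
          rw [hrow]
          ext j
          simp [Matrix.single_vecMul]
  -- If `t·t = 0`, then `t` would be killed by the invertible `𝕋`.
  have hne : ∑ i, t i * t i ≠ 0 := fun h0 => ht0 (by rw [h]; funext j; simp [h0])
  refine ⟨(∑ i, t i * t i)⁻¹, inv_ne_zero hne, fun j => ?_⟩
  conv_rhs => rw [congrFun h j]
  rw [inv_mul_cancel_left₀ hne]

theorem psi_apply_of_row {t : Fin 3 → k} {c : k} (hc : ∀ j, (TMatrix p t)⁻¹ 0 j = c * t j)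
    (S : S3 (Fpn k p 2)) :
    psi p t S = ∑ j, (∑ i, c * t i * (S.1 i j : k)) * t j := by
  simp only [psi, LinearMap.coe_mk, AddHom.coe_mk, Matrix.mul_apply, hc]
  rfl

end Independence

/-! ### The image of `ψ_t` as a span of quadratic monomials. -/

section Span

open scoped Pointwise

variable {k : Type*} [Field k]

theorem span_mul_span_eq_veronese {F : Type*} [Field F] [Algebra F k] (t : Fin 3 → k) :
    Submodule.span F (Set.range t) * Submodule.span F (Set.range t) =
      Submodule.span F (Set.range (veronese t)) := by
  rw [Submodule.span_mul_span]
  apply le_antisymm <;> rw [Submodule.span_le]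
  · rintro _ ⟨_, ⟨i, rfl⟩, _, ⟨j, rfl⟩, rfl⟩
    apply Submodule.subset_span
    fin_cases i <;> fin_cases j
    exacts [⟨0, by simp [veronese, sq]⟩, ⟨3, by simp [veronese]⟩, ⟨4, by simp [veronese]⟩,
      ⟨3, mul_comm _ _⟩, ⟨1, by simp [veronese, sq]⟩, ⟨5, by simp [veronese]⟩,
      ⟨4, mul_comm _ _⟩, ⟨5, mul_comm _ _⟩,
      ⟨2, by simp [veronese, sq]⟩]
  · rintro _ ⟨i, rfl⟩
    apply Submodule.subset_span
    have h (a b : Fin 3) : t a * t b ∈ Set.range t * Set.range t :=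
      Set.mul_mem_mul ⟨a, rfl⟩ ⟨b, rfl⟩
    fin_cases i <;> simp [veronese, sq, h]

theorem finrank_span_range_mul {F ι : Type*} [Field F] [Algebra F k] {c : k} (hc : c ≠ 0)
    (v : ι → k) : finrank F (Submodule.span F (Set.range fun i => c * v i)) =
      finrank F (Submodule.span F (Set.range v)) := by
  have h : Set.range (fun i => c * v i) = LinearMap.mulLeft F c '' Set.range v := by
    rw [← Set.range_comp]
    rfl
  rw [h, Submodule.span_image]
  exact (Submodule.equivMapOfInjective _ (mul_right_injective₀ hc) _).finrank_eq.symm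

theorem veronese_mul (c : k) (t : Fin 3 → k) :
    veronese (fun i => c * t i) = fun i => c ^ 2 * veronese t i := by
  ext i
  fin_cases i <;> simp [veronese] <;> ring

variable (p : ℕ) [Fact p.Prime] [CharP k p]

/-- In `tᵀ S t` each off-diagonal entry counts twice, so reaching the mixed monomials takes the
entry `2⁻¹`. -/
theorem range_psi_of_odd [IsAlgClosed k] {t : Fin 3 → k} {c : k}
    (hc : ∀ j, (TMatrix p t)⁻¹ 0 j = c * t j) (hp : p ≠ 2) : LinearMap.range (psi p t) =
      Submodule.span (Fpn k p 2) (Set.range fun i => c * veronese t i) := by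
  have h2 : (2 : k) ≠ 0 := Ring.two_ne_zero (by rwa [ringChar.eq k p])
  have h2' : ((2 : Fpn k p 2) : k) = 2 := rfl
  apply le_antisymm
  · rintro _ ⟨S, rfl⟩
    rw [psi_apply_of_row p hc, Submodule.mem_span_range_iff_exists_fun]
    refine ⟨![S.1 0 0, S.1 1 1, S.1 2 2, 2 * S.1 0 1, 2 * S.1 0 2, 2 * S.1 1 2], ?_⟩
    have h01 : S.1 1 0 = S.1 0 1 := S.2.apply 0 1
    have h02 : S.1 2 0 = S.1 0 2 := S.2.apply 0 2
    have h12 : S.1 2 1 = S.1 1 2 := S.2.apply 1 2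
    simp [Fin.sum_univ_six, Fin.sum_univ_three, veronese, Subfield.smul_def, h01, h02, h12, h2']
    ring
  · rw [Submodule.span_le]
    have key (a : Fin 6 → Fpn k p 2) :
        c * (a 0 * t 0 ^ 2 + a 1 * t 1 ^ 2 + a 2 * t 2 ^ 2 +
          2 * (a 3 * (t 0 * t 1) + a 4 * (t 0 * t 2) + a 5 * (t 1 * t 2))) ∈
          LinearMap.range (psi p t) := by
      refine ⟨⟨!![a 0, a 3, a 4; a 3, a 1, a 5; a 4, a 5, a 2], ?_⟩, ?_⟩
      · refine Matrix.IsSymm.ext fun i j => ?_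
        fin_cases i <;> fin_cases j <;> rfl
      · rw [psi_apply_of_row p hc]
        simp [Fin.sum_univ_three]
        ring
    rintro _ ⟨i, rfl⟩
    fin_cases i
    · simpa [veronese] using key ![1, 0, 0, 0, 0, 0]
    · simpa [veronese] using key ![0, 1, 0, 0, 0, 0]
    · simpa [veronese] using key ![0, 0, 1, 0, 0, 0]
    · simpa [veronese, h2, h2'] using key ![0, 0, 0, 2⁻¹, 0, 0]
    · simpa [veronese, h2, h2'] using key ![0, 0, 0, 0, 2⁻¹, 0]
    · simpa [veronese, h2, h2'] using key ![0, 0, 0, 0, 0, 2⁻¹]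

/-- The doubled off-diagonal terms vanish, and diagonal matrices already give everything. -/
theorem range_psi_of_two [IsAlgClosed k] {t : Fin 3 → k} {c : k}
    (hc : ∀ j, (TMatrix p t)⁻¹ 0 j = c * t j) (hp : p = 2) : LinearMap.range (psi p t) =
      Submodule.span (Fpn k p 2) (Set.range fun i => c * t i ^ 2) := by
  have h2 : (2 : k) = 0 := by
    subst hp
    exact CharTwo.two_eq_zero
  apply le_antisymm
  · rintro _ ⟨S, rfl⟩
    rw [psi_apply_of_row p hc, Submodule.mem_span_range_iff_exists_fun]
    refine ⟨fun i => S.1 i i, ?_⟩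
    have h01 : S.1 1 0 = S.1 0 1 := S.2.apply 0 1
    have h02 : S.1 2 0 = S.1 0 2 := S.2.apply 0 2
    have h12 : S.1 2 1 = S.1 1 2 := S.2.apply 1 2
    simp only [Fin.sum_univ_three, Subfield.smul_def, h01, h02, h12, smul_eq_mul]
    linear_combination (-c * (t 0 * t 1 * S.1 0 1 + t 0 * t 2 * S.1 0 2 + t 1 * t 2 * S.1 1 2)) * h2
  · rw [Submodule.span_le]
    rintro _ ⟨l, rfl⟩
    refine ⟨⟨Matrix.diagonal (Pi.single l 1), Matrix.isSymm_diagonal _⟩, ?_⟩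
    rw [psi_apply_of_row p hc]
    fin_cases l <;> simp [Fin.sum_univ_three, Matrix.diagonal_apply, Pi.single_apply] <;> ring

/-- Since `g⁴ = g` on `𝔽₄`, a relation `∑ gᵢ tᵢ² = 0` is the square of `∑ gᵢ² tᵢ = 0`. -/
theorem linearIndependent_sq_of_two (hp : p = 2) {t : Fin 3 → k}
    (ht : LinearIndependent (Fpn k p 2) t) :
    LinearIndependent (Fpn k p 2) fun i => t i ^ 2 := by
  rw [Fintype.linearIndependent_iff] at ht ⊢
  intro g hg i
  have hg4 (i) : (g i : k) ^ 4 = g i := by simpa [hp] using (mem_Fpn p).1 (g i).2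
  have h := ht (fun i => g i ^ 2) (by
    subst hp
    apply frobenius_inj k 2
    rw [map_zero, ← hg, map_sum]
    refine Finset.sum_congr rfl fun i _ => ?_
    simp only [Subfield.smul_def, smul_eq_mul, frobenius_def, mul_pow, SubmonoidClass.coe_pow,
      ← pow_mul, hg4]) i
  simpa using h

end Span

/-! ### The values of `d(t)`. -/

section Main

variable {k : Type*} [Field k] (p : ℕ) [Fact p.Prime] [CharP k p]

theorem d_eq_three_of_two [IsAlgClosed k] (hp : p = 2) {t : Fin 3 → k} (ht : t ≠ 0)
    (htC : Projectivization.mk k t ht ∈ fermatCurve0 k p) : d p t = 3 := by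
  have hli := linearIndependent_of_mem_fermatCurve0 p ht htC
  obtain ⟨c, hc0, hc⟩ := exists_TMatrix_inv_row p ((mk_mem_fermatCurve p t ht).1 htC.1) ht hli
  rw [d, range_psi_of_two p hc hp, finrank_span_range_mul hc0,
    finrank_span_eq_card (linearIndependent_sq_of_two p hp hli), Fintype.card_fin]

theorem d_eq_finrank_span_veronese [IsAlgClosed k] (hp : p ≠ 2) {t : Fin 3 → k} (ht : t ≠ 0)
    (htC : Projectivization.mk k t ht ∈ fermatCurve0 k p) :
    d p t = finrank (Fpn k p 2) (Submodule.span (Fpn k p 2) (Set.range (veronese t))) := by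
  have hli := linearIndependent_of_mem_fermatCurve0 p ht htC
  obtain ⟨c, hc0, hc⟩ := exists_TMatrix_inv_row p ((mk_mem_fermatCurve p t ht).1 htC.1) ht hli
  rw [d, range_psi_of_odd p hc hp, finrank_span_range_mul hc0]

theorem finrank_span_veronese_eq_six_iff [IsAlgClosed k] (t : Fin 3 → k) :
    finrank (Fpn k p 2) (Submodule.span (Fpn k p 2) (Set.range (veronese t))) = 6 ↔
      (deltaMatrix p t).det ≠ 0 := by
  rw [deltaMatrix, moore_det_ne_zero_iff p two_ne_zero, linearIndependent_iff_card_eq_finrank_span,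
    Fintype.card_fin, eq_comm]
  rfl

theorem finrank_span_veronese_le_of_mem [IsAlgClosed k] {m : ℕ} (hm : m ≠ 0) {t : Fin 3 → k}
    (h : ∀ i, t i ∈ Fpn k p (2 * m)) :
    finrank (Fpn k p 2) (Submodule.span (Fpn k p 2) (Set.range (veronese t))) ≤ m := by
  have := finite_FpnSubmodule (k := k) p two_ne_zero hm
  have hle : Submodule.span (Fpn k p 2) (Set.range (veronese t)) ≤ FpnSubmodule k p 2 m := by
    rw [Submodule.span_le]
    rintro _ ⟨i, rfl⟩
    rw [SetLike.mem_coe, mem_FpnSubmodule]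
    fin_cases i <;> simp [veronese, sq, mul_mem, h]
  exact (Submodule.finrank_mono hle).trans_eq (finrank_FpnSubmodule p two_ne_zero hm)

theorem three_le_finrank_span_veronese {y : Fin 3 → k} (hy : LinearIndependent (Fpn k p 2) y)
    (h1 : y 0 = 1) :
    3 ≤ finrank (Fpn k p 2) (Submodule.span (Fpn k p 2) (Set.range (veronese y))) := by
  have : FiniteDimensional (Fpn k p 2) (Submodule.span (Fpn k p 2) (Set.range (veronese y))) :=
    FiniteDimensional.span_of_finite _ (Set.finite_range _)
  have hV := finrank_span_eq_card hy
  rw [Fintype.card_fin] at hV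
  rw [← hV]
  apply Submodule.finrank_mono
  rw [← span_mul_span_eq_veronese]
  exact le_mul_self_of_one_mem (h1 ▸ Submodule.subset_span ⟨0, rfl⟩)

theorem finrank_span_veronese_eq_three_iff [IsAlgClosed k] {y : Fin 3 → k}
    (hy : LinearIndependent (Fpn k p 2) y) (h1 : y 0 = 1) :
    finrank (Fpn k p 2) (Submodule.span (Fpn k p 2) (Set.range (veronese y))) = 3 ↔
      ∀ i, y i ∈ Fpn k p 6 := by
  constructor
  · intro h i
    rw [← span_mul_span_eq_veronese] at h
    have hV := finrank_span_eq_card hy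
    rw [Fintype.card_fin] at hV
    have : FiniteDimensional (Fpn k p 2) (Submodule.span (Fpn k p 2) (Set.range y)) :=
      FiniteDimensional.span_of_finite _ (Set.finite_range _)
    obtain ⟨A, hA⟩ := exists_subalgebra_eq_of_finrank_mul_self
      (h1 ▸ Submodule.subset_span ⟨0, rfl⟩) (h.trans hV.symm)
    refine mem_Fpn_of_mem_subalgebra p two_ne_zero three_ne_zero A ?_ ?_
    · rw [← hV, ← hA]
      rfl
    · rw [← Subalgebra.mem_toSubmodule, hA]
      exact Submodule.subset_span ⟨i, rfl⟩
  · intro h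
    exact le_antisymm (finrank_span_veronese_le_of_mem p three_ne_zero h)
      (three_le_finrank_span_veronese p hy h1)

/-- Used to exclude dimension 3 for points over `𝔽_{p⁸}`, which would then be `𝔽_{p²}`-rational. -/
theorem mem_Fpn_two_of_mem {x : k} (h6 : x ∈ Fpn k p 6) (h8 : x ∈ Fpn k p 8) :
    x ∈ Fpn k p 2 := by
  rw [mem_Fpn] at *
  rwa [show 8 = 6 + 2 from rfl, pow_add, pow_mul, h6] at h8

theorem finrank_span_veronese_eq_four_iff [IsAlgClosed k] (hp : p ≠ 2) {y : Fin 3 → k}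
    (hy : LinearIndependent (Fpn k p 2) y) (h1 : y 0 = 1) (h2 : ¬ ∀ i, y i ∈ Fpn k p 2) :
    finrank (Fpn k p 2) (Submodule.span (Fpn k p 2) (Set.range (veronese y))) = 4 ↔
      ∀ i, y i ∈ Fpn k p 8 := by
  constructor
  · intro h i
    rw [← span_mul_span_eq_veronese] at h
    have hV := finrank_span_eq_card hy
    rw [Fintype.card_fin] at hV
    have h2 : (2 : Fpn k p 2) ≠ 0 := fun h =>
      Ring.two_ne_zero (R := k) (by rwa [ringChar.eq k p]) (congrArg Subtype.val h)
    obtain ⟨E, hE, hVE⟩ := exists_intermediateField_of_finrank_mul_self_eq_four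
      (h1 ▸ Submodule.subset_span ⟨0, rfl⟩) h2 hV h
    exact mem_Fpn_of_mem_subalgebra p two_ne_zero four_ne_zero E.toSubalgebra hE
      (hVE _ (Submodule.subset_span ⟨i, rfl⟩))
  · intro h
    have h4 := finrank_span_veronese_le_of_mem p four_ne_zero h
    have h3 := three_le_finrank_span_veronese p hy h1
    have hne := mt (finrank_span_veronese_eq_three_iff p hy h1).1
      fun h6 => h2 fun i => mem_Fpn_two_of_mem p (h6 i) (h i)
    omega

end Main

end FermatDim

theorem mainTheorem5 {k : Type*} [Field k] [IsAlgClosed k] (p : ℕ) [Fact p.Prime] [CharP k p]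
    (t : Fin 3 → k) (ht : t ≠ 0)
    (htC : Projectivization.mk k t ht ∈ FermatDim.fermatCurve0 k p) :
    (3 ≤ FermatDim.d p t ∧ FermatDim.d p t ≤ 6) ∧
    (p = 2 → FermatDim.d p t = 3) ∧
    (p ≠ 2 →
      (FermatDim.d p t = 3 ↔
        Projectivization.mk k t ht ∈ FermatDim.fermatCurve0Points k p 6) ∧
      (FermatDim.d p t = 4 ↔
        Projectivization.mk k t ht ∈ FermatDim.fermatCurve0Points k p 8) ∧
      (FermatDim.d p t = 5 ↔
        Projectivization.mk k t ht ∈ (FermatDim.Delta k p ∩ FermatDim.fermatCurve0 k p) \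
          (FermatDim.fermatCurve0Points k p 6 ∪ FermatDim.fermatCurve0Points k p 8)) ∧
      (FermatDim.d p t = 6 ↔
        Projectivization.mk k t ht ∉ FermatDim.Delta k p ∩ FermatDim.fermatCurve0 k p)) := by
  open FermatDim in
  by_cases hp : p = 2
  · have h3 := d_eq_three_of_two p hp ht htC
    exact ⟨by omega, fun _ => h3, fun h => absurd hp h⟩
  have hli := linearIndependent_of_mem_fermatCurve0 p ht htC
  have h0 : t 0 ≠ 0 := hli.ne_zero 0
  have hd := d_eq_finrank_span_veronese p hp ht htC
  have hd6 := finrank_span_veronese_eq_six_iff p t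
  have hle := finrank_range_le_card (R := Fpn k p 2) (veronese t)
  rw [Set.finrank, Fintype.card_fin, ← hd] at hle
  rw [← hd] at hd6
  -- Dividing by `t 0` puts `1` in the span and only rescales the products, leaving the dimension
  -- unchanged.
  have hy : LinearIndependent (Fpn k p 2) fun i => (t 0)⁻¹ * t i :=
    hli.map' (LinearMap.mulLeft (Fpn k p 2) (t 0)⁻¹)
      (LinearMap.ker_eq_bot.2 (mul_right_injective₀ (inv_ne_zero h0)))
  have h1 : (t 0)⁻¹ * t 0 = 1 := inv_mul_cancel₀ h0
  have hdy : Module.finrank (Fpn k p 2) (Submodule.span (Fpn k p 2)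
      (Set.range (veronese fun i => (t 0)⁻¹ * t i))) = d p t := by
    rw [veronese_mul, finrank_span_range_mul (pow_ne_zero 2 (inv_ne_zero h0)), hd]
  have hge := three_le_finrank_span_veronese p hy h1
  have hd3 := finrank_span_veronese_eq_three_iff p hy h1
  have hd4 := finrank_span_veronese_eq_four_iff p hp hy h1
    (mt (mk_mem_rationalPoints_iff p ht h0).2 htC.2)
  rw [hdy, ← mk_mem_rationalPoints_iff p ht h0] at hd3 hd4
  rw [hdy] at hge
  have hΔ := mk_mem_Delta p t ht
  refine ⟨⟨hge, hle⟩, fun h => absurd h hp, fun _ => ?_⟩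
  simp only [fermatCurve0Points, Set.mem_sdiff, Set.mem_union, Set.mem_inter_iff, htC, true_and,
    and_true, hΔ, ← hd3, ← hd4]
  refine ⟨?_, hd6⟩
  -- With all conditions expressed through `d p t`, the case 5 follows from `3 ≤ d p t ≤ 6`.
  have hdet : (deltaMatrix p t).det = 0 ↔ d p t ≠ 6 := by rw [Ne, hd6, not_not]
  rw [hdet]
  omega
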